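/- Let $V$ be an $\ell$-dimensional unitary space, i.e. a complex inner product space of finite dimension $\ell$, and let $W\subset \mathbf{GL}(V)$ be a finite group generated by unitary reflections (unitary transformations whose fixed space is a hyperplane). Let $\mathcal A$ be the set of the reflecting hyperplanes of $W$, i.e. of the fixed spaces of the reflections in $W$. For each $H\in\mathcal A$ choose $\alpha_H\in V^*$ with $H=\ker\alpha_H$, and put $Q=\prod_{H\in\mathcal A}\alpha_H$. Let $S$ be the algebra of polynomial functions on $V$, let $\Omega^p\cong S\otimes_{\mathbf C}\bigwedge^pV^*$ be the module of differential $p$-forms on $V$ with coefficients in $S$ (so $\Omega^0=S$), and let $$\Omega^p(\mathcal A)=\Big\{\tfrac{\eta}{Q}\ \Big|\ \eta\in\Omega^p,\ d\big(\tfrac{\eta}{Q}\big)\in\tfrac1Q\,\Omega^{p+1}\Big\}$$ be the module of logarithmic $p$-forms with poles along $\mathcal A$, where $d$ is the exterior differentiation of differential forms with rational coefficients. The group $W$ acts contragradiently on $V^*$, and hence on $S$, on its field of fractions, and on polynomial and rational differential forms. Let $(\Omega^p(\mathcal A))^W$ be the set of $\omega\in\Omega^p(\mathcal A)$ with $w\omega=\omega$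 for all $w\in W$, and let $(\Omega^p)^{\det^{-1}}$ be the set of anti-invariant $p$-forms, i.e. of $\eta\in\Omega^p$ with $w\eta=\det(w)^{-1}\eta$ for all $w\in W$. Then, for $0\le p\le\ell$, $$(\Omega^p(\mathcal A))^W=\frac1Q\,(\Omega^p)^{\det^{-1}}.$$ -/

import Mathlib

open Module

noncomputable section

namespace ReflArr

set_option linter.unusedSectionVars false

variable (V : Type*) [NormedAddCommGroup V] [InnerProductSpace ℂ V] [FiniteDimensional ℂ V]

/-- The algebra `S` of polynomial functions on `V`: the symmetric algebra of the dual space `V*`. -/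
abbrev PolyFun : Type _ := SymmetricAlgebra ℂ (Dual ℂ V)

/-- The field of rational functions on `V`. -/
abbrev RatFun : Type _ := FractionRing (PolyFun V)

/-- The module `Ω^p ≅ S ⊗ ⋀^p V*` of polynomial differential `p`-forms on `V`: alternating `p`-forms
on `V` with coefficients in `S`. A form is given by its values on the constant vector fields. -/
abbrev PolyForm (p : ℕ) : Type _ := V [⋀^Fin p]→ₗ[ℂ] PolyFun V

/-- Rational differential `p`-forms on `V`. -/
abbrev RatForm (p : ℕ) : Type _ := V [⋀^Fin p]→ₗ[ℂ] RatFun V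

variable {V}

/-- The inclusion of the polynomial `p`-forms into the rational `p`-forms. -/
def PolyForm.toRat {p : ℕ} (η : PolyForm V p) : RatForm V p :=
  (IsScalarTower.toAlgHom ℂ (PolyFun V) (RatFun V)).toLinearMap.compAlternatingMap η

/-- The linear form `x ∈ V*` as a rational function. -/
def linRat : Dual ℂ V →ₗ[ℂ] RatFun V :=
  (IsScalarTower.toAlgHom ℂ (PolyFun V) (RatFun V)).toLinearMap ∘ₗ SymmetricAlgebra.ι ℂ (Dual ℂ V)

theorem linRat_apply (x : Dual ℂ V) :
    linRat x = algebraMap (PolyFun V) (RatFun V) (SymmetricAlgebra.ι ℂ _ x) := rfl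

/-- A derivation of the field of rational functions is determined by its values on `V*`. -/
theorem derivation_ext {D E : Derivation ℂ (RatFun V) (RatFun V)}
    (h : ∀ x : Dual ℂ V, D (linRat x) = E (linRat x)) : D = E := by
  have hS : ∀ f : PolyFun V, D (algebraMap _ _ f) = E (algebraMap _ _ f) := by
    intro f
    induction f using SymmetricAlgebra.induction with
    | algebraMap r =>
      rw [← IsScalarTower.algebraMap_apply]
      simp
    | ι x => exact h x
    | mul a b ha hb => simp [ha, hb]
    | add a b ha hb => simp [ha, hb]
  ext z
  obtain ⟨a, b, hb, rfl⟩ := IsFractionRing.div_surjective (A := PolyFun V) z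
  have hb' : algebraMap (PolyFun V) (RatFun V) b ≠ 0 :=
    IsFractionRing.to_map_ne_zero_of_mem_nonZeroDivisors hb
  generalize hz : algebraMap (PolyFun V) (RatFun V) a / algebraMap (PolyFun V) (RatFun V) b = z
  have ha : algebraMap (PolyFun V) (RatFun V) a = z * algebraMap (PolyFun V) (RatFun V) b := by
    rw [← hz]
    field_simp
  have h1 := hS a
  rw [ha] at h1
  simp only [Derivation.leibniz, hS b, smul_eq_mul] at h1
  exact mul_left_cancel₀ hb' (add_left_cancel h1)

/-- The map `f ↦ f + ε ∂_v f` from polynomials to the dual numbers over the rational functions. -/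
def polyTaylor (v : V) : PolyFun V →ₐ[ℂ] TrivSqZeroExt (RatFun V) (RatFun V) :=
  SymmetricAlgebra.lift
    ((TrivSqZeroExt.inlAlgHom ℂ (RatFun V) (RatFun V)).toLinearMap ∘ₗ linRat +
      (TrivSqZeroExt.inrHom (RatFun V) (RatFun V)).restrictScalars ℂ ∘ₗ
        Algebra.linearMap ℂ (RatFun V) ∘ₗ Dual.eval ℂ V v)

theorem fst_polyTaylor (v : V) (f : PolyFun V) :
    (polyTaylor v f).fst = algebraMap (PolyFun V) (RatFun V) f := by
  have : (TrivSqZeroExt.fstHom ℂ (RatFun V) (RatFun V)).comp (polyTaylor v) =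
      IsScalarTower.toAlgHom ℂ (PolyFun V) (RatFun V) := by
    apply SymmetricAlgebra.algHom_ext
    refine LinearMap.ext fun x => ?_
    simp [polyTaylor, linRat_apply]
  exact DFunLike.congr_fun this f

/-- The map `f ↦ f + ε ∂_v f` from rational functions to the dual numbers over them. -/
def ratTaylor (v : V) : RatFun V →ₐ[ℂ] TrivSqZeroExt (RatFun V) (RatFun V) :=
  IsLocalization.liftAlgHom (M := nonZeroDivisors (PolyFun V)) (f := polyTaylor v) (fun b => by
    rw [TrivSqZeroExt.isUnit_iff_isUnit_fst, fst_polyTaylor]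
    exact IsLocalization.map_units (RatFun V) b)

theorem ratTaylor_algebraMap (v : V) (f : PolyFun V) :
    ratTaylor v (algebraMap (PolyFun V) (RatFun V) f) = polyTaylor v f := by
  simp [ratTaylor]

theorem fst_ratTaylor (v : V) (f : RatFun V) : (ratTaylor v f).fst = f := by
  have : (TrivSqZeroExt.fstHom ℂ (RatFun V) (RatFun V)).comp (ratTaylor v) =
      AlgHom.id ℂ (RatFun V) := by
    apply IsLocalization.algHom_ext (nonZeroDivisors (PolyFun V))
    refine AlgHom.ext fun f => ?_
    change (ratTaylor v (algebraMap (PolyFun V) (RatFun V) f)).fst = algebraMap (PolyFun V) (RatFun V) f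
    rw [ratTaylor_algebraMap, fst_polyTaylor]
  exact DFunLike.congr_fun this f

/-- The derivation `∂_v` of the field of rational functions. -/
def partialDerivAux (v : V) : Derivation ℂ (RatFun V) (RatFun V) :=
  Derivation.mk'
    ((TrivSqZeroExt.sndHom (RatFun V) (RatFun V)).restrictScalars ℂ ∘ₗ (ratTaylor v).toLinearMap)
    (fun a b => by simp [fst_ratTaylor, mul_comm])

theorem partialDerivAux_linRat (v : V) (x : Dual ℂ V) :
    partialDerivAux v (linRat x) = algebraMap ℂ (RatFun V) (x v) := by
  have h : partialDerivAux v (linRat x) = (ratTaylor v (linRat x)).snd := rfl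
  rw [h, linRat_apply, ratTaylor_algebraMap]
  simp [polyTaylor, linRat_apply, Algebra.algebraMap_eq_smul_one]

/-- The derivation `∂_v` of the field of rational functions, linear in `v ∈ V`. -/
def partialDeriv : V →ₗ[ℂ] Derivation ℂ (RatFun V) (RatFun V) where
  toFun := partialDerivAux
  map_add' u v := derivation_ext fun x => by simp [partialDerivAux_linRat]
  map_smul' c v := derivation_ext fun x => by
    simp [partialDerivAux_linRat, Algebra.smul_def]

/-- `∂_v x = ⟨x, v⟩` for `x ∈ V*`; by `derivation_ext` this characterizes `∂_v`. -/
theorem partialDeriv_linRat (v : V) (x : Dual ℂ V) :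
    partialDeriv v (linRat x) = algebraMap ℂ (RatFun V) (x v) :=
  partialDerivAux_linRat v x

/-- The exterior differentiation of rational forms,
`(dω)(v₀, …, v_p) = ∑ i, (-1)^i ∂_{v_i} (ω(v₀, …, v̂_i, …, v_p))`. -/
def extD {p : ℕ} (ω : RatForm V p) : RatForm V (p + 1) :=
  AlternatingMap.alternatizeUncurryFin
    { toFun := fun v => (partialDeriv v).toLinearMap.compAlternatingMap ω
      map_add' := fun u v => by
        ext
        simp
      map_smul' := fun c v => by
        ext
        simp }

theorem extD_apply {p : ℕ} (ω : RatForm V p) (v : Fin (p + 1) → V) :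
    extD ω v = ∑ i : Fin (p + 1), (-1) ^ (i : ℕ) • partialDeriv (v i) (ω (i.removeNth v)) := by
  simp [extD, AlternatingMap.alternatizeUncurryFin_apply]

/-- The rational form `η / Q`. -/
def divForm (Q : PolyFun V) {p : ℕ} (η : PolyForm V p) : RatForm V p :=
  (algebraMap (PolyFun V) (RatFun V) Q)⁻¹ • η.toRat

/-- The logarithmic `p`-forms with poles along `Q = 0`: the rational forms `η / Q` with `η ∈ Ω^p` and
`d(η / Q) ∈ (1 / Q) Ω^{p+1}`. -/
def logForms (Q : PolyFun V) (p : ℕ) : Set (RatForm V p) :=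
  {ω | (∃ η : PolyForm V p, ω = divForm Q η) ∧ ∃ ξ : PolyForm V (p + 1), extD ω = divForm Q ξ}

/-- The algebra map of `S` extending the contragredient action `x ↦ x ∘ w⁻¹` on `V*`. -/
def polyActHom (w : V ≃ₗ[ℂ] V) : PolyFun V →ₐ[ℂ] PolyFun V :=
  SymmetricAlgebra.lift (SymmetricAlgebra.ι ℂ (Dual ℂ V) ∘ₗ (w⁻¹ : V ≃ₗ[ℂ] V).toLinearMap.dualMap)

theorem polyActHom_ι (w : V ≃ₗ[ℂ] V) (x : Dual ℂ V) :
    polyActHom w (SymmetricAlgebra.ι ℂ _ x) =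
      SymmetricAlgebra.ι ℂ _ (x ∘ₗ (w⁻¹ : V ≃ₗ[ℂ] V).toLinearMap) := by
  simp [polyActHom, LinearMap.dualMap_apply']

theorem polyActHom_comp_inv (w : V ≃ₗ[ℂ] V) :
    (polyActHom w).comp (polyActHom w⁻¹) = AlgHom.id ℂ (PolyFun V) := by
  apply SymmetricAlgebra.algHom_ext
  refine LinearMap.ext fun x => ?_
  change polyActHom w (polyActHom w⁻¹ (SymmetricAlgebra.ι ℂ _ x)) = SymmetricAlgebra.ι ℂ _ x
  rw [polyActHom_ι, polyActHom_ι]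
  congr 1
  ext v
  simp

/-- The action of `w ∈ GL(V)` on the algebra `S` of polynomial functions. -/
def polyAct (w : V ≃ₗ[ℂ] V) : PolyFun V ≃ₐ[ℂ] PolyFun V :=
  AlgEquiv.ofAlgHom (polyActHom w) (polyActHom w⁻¹) (polyActHom_comp_inv w)
    (by simpa using polyActHom_comp_inv w⁻¹)

/-- The action of `w ∈ GL(V)` on the field of rational functions. -/
def ratAct (w : V ≃ₗ[ℂ] V) : RatFun V ≃ₐ[ℂ] RatFun V :=
  IsFractionRing.fieldEquivOfAlgEquiv ℂ (RatFun V) (RatFun V) (polyAct w)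

/-- The action of `w ∈ GL(V)` on polynomial forms: `(w η)(v₁, …, v_p) = w (η(w⁻¹v₁, …, w⁻¹v_p))`. -/
def polyFormAct (w : V ≃ₗ[ℂ] V) {p : ℕ} (η : PolyForm V p) : PolyForm V p :=
  (polyAct w).toLinearMap.compAlternatingMap (η.compLinearMap (w⁻¹ : V ≃ₗ[ℂ] V).toLinearMap)

/-- The action of `w ∈ GL(V)` on rational forms: `(w ω)(v₁, …, v_p) = w (ω(w⁻¹v₁, …, w⁻¹v_p))`. -/
def ratFormAct (w : V ≃ₗ[ℂ] V) {p : ℕ} (ω : RatForm V p) : RatForm V p :=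
  (ratAct w).toLinearMap.compAlternatingMap (ω.compLinearMap (w⁻¹ : V ≃ₗ[ℂ] V).toLinearMap)

/-- The fixed space of `s`. -/
def fixedSpace (s : V ≃ₗ[ℂ] V) : Submodule ℂ V := LinearMap.ker (s.toLinearMap - LinearMap.id)

/-- A unitary reflection: a unitary transformation whose fixed space is a hyperplane. -/
def IsUnitaryReflection (s : V ≃ₗ[ℂ] V) : Prop :=
  (∀ x y : V, inner ℂ (s x) (s y) = inner ℂ x y) ∧ finrank ℂ (fixedSpace s) + 1 = finrank ℂ V

/-- `W ⊆ GL(V)` is a unitary reflection group: finite, and generated by unitary reflections. -/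
def IsUnitaryReflectionGroup (W : Subgroup (V ≃ₗ[ℂ] V)) : Prop :=
  Finite W ∧ Subgroup.closure {s | s ∈ W ∧ IsUnitaryReflection s} = W

/-- The reflection arrangement of `W`: the set of the reflecting hyperplanes. -/
def arrangement (W : Subgroup (V ≃ₗ[ℂ] V)) : Set (Submodule ℂ V) :=
  {H | ∃ s ∈ W, IsUnitaryReflection s ∧ H = fixedSpace s}

/-- The arrangement of a finite group is finite. -/
theorem finite_arrangement (W : Subgroup (V ≃ₗ[ℂ] V)) [Finite W] : (arrangement W).Finite := by
  have h : ((fun s => fixedSpace s) '' (W : Set (V ≃ₗ[ℂ] V))).Finite :=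
    (Set.toFinite (W : Set (V ≃ₗ[ℂ] V))).image _
  refine h.subset ?_
  rintro H ⟨s, hs, -, rfl⟩
  exact ⟨s, hs, rfl⟩

/-- `Q = ∏ α_H`, the product over the hyperplanes `H` of the arrangement of `W` (a finite product
when `W` is finite). -/
def definingPoly {W : Subgroup (V ≃ₗ[ℂ] V)} (α : arrangement W → Dual ℂ V) : PolyFun V :=
  ∏ᶠ H : arrangement W, SymmetricAlgebra.ι ℂ (Dual ℂ V) (α H)

/-- The anti-invariant `p`-forms: `η ∈ Ω^p` with `w η = det(w)⁻¹ η` for all `w ∈ W`. -/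
def antiInvariantForms (W : Subgroup (V ≃ₗ[ℂ] V)) (p : ℕ) : Set (PolyForm V p) :=
  {η | ∀ w ∈ W, polyFormAct w η = (LinearMap.det w.toLinearMap)⁻¹ • η}

/-- The `W`-invariant elements of a set of rational `p`-forms. -/
def invariants (W : Subgroup (V ≃ₗ[ℂ] V)) {p : ℕ} (M : Set (RatForm V p)) : Set (RatForm V p) :=
  {ω | ω ∈ M ∧ ∀ w ∈ W, ratFormAct w ω = ω}

end ReflArr

end

namespace ReflArr

set_option linter.unusedSectionVars false

/-! Every `w` in `W` multiplies `Q` by `det(w)⁻¹` (`polyAct_definingPoly`), so `η / Q` is invariant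
exactly when `η` is anti-invariant. What remains is that `d(η / Q)` has at most a simple pole along
`Q` when `η` is anti-invariant.

Since `Q · d(η / Q) = dη - ∑ (dα_H / α_H) ∧ η`, it suffices that each `α_H` divides `dα_H ∧ η`. Let
`s` be a reflection in `H`. On vectors of `H`, which `s` fixes, the value of `η` is a polynomial
multiplied by `det(s)⁻¹ ≠ 1` under `s`, hence divisible by `α_H`. So modulo `α_H` the form `η`
vanishes on `H`, and its wedge product with `dα_H` is zero. -/

/-- If `g` vanishes on the hyperplane `a = 0`, then `a ∧ g = 0`. -/
theorem sum_smul_removeNth_eq_zero {K V M : Type*} [Field K] [AddCommGroup V] [Module K V]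
    [FiniteDimensional K V] [AddCommGroup M] [Module K M] {p : ℕ} (a : Dual K V)
    (g : V [⋀^Fin p]→ₗ[K] M) (hg : ∀ v : Fin p → V, (∀ i, a (v i) = 0) → g v = 0)
    (v : Fin (p + 1) → V) :
    ∑ i : Fin (p + 1), (-1) ^ (i : ℕ) • a (v i) • g (i.removeNth v) = 0 := by
  by_cases ha : a = 0
  · simp [ha]
  obtain ⟨e, he⟩ : ∃ e, a e = 1 := by
    obtain ⟨x, hx⟩ := DFunLike.ne_iff.mp ha
    exact ⟨(a x)⁻¹ • x, by simp only [map_smul, smul_eq_mul]; exact inv_mul_cancel₀ hx⟩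
  -- A basis adapted to the hyperplane: `a` is nonzero only on the vector of index `0`.
  let b := Basis.mkFinCons e (finBasis K (LinearMap.ker a))
    (fun c x hx h => by
      have := congrArg a h
      simpa [he, LinearMap.mem_ker.mp hx] using this)
    (fun z => ⟨-a z, by simp [he]⟩)
  have hb : ∀ j, j ≠ 0 → a (b j) = 0 := by
    intro j hj
    obtain ⟨k, rfl⟩ := Fin.exists_succ_eq.mpr hj
    simp [b, Basis.coe_mkFinCons]
  suffices h : AlternatingMap.alternatizeUncurryFin (LinearMap.smulRight a g) = 0 by
    simpa [AlternatingMap.alternatizeUncurryFin_apply] using DFunLike.congr_fun h v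
  refine Basis.ext_alternating b fun u hu => ?_
  rw [AlternatingMap.alternatizeUncurryFin_apply]
  simp only [LinearMap.smulRight_apply, AlternatingMap.smul_apply, AlternatingMap.zero_apply]
  -- Each term vanishes: if `u i = 0`, injectivity of `u` puts all the other vectors in `ker a`,
  -- where `g` is zero; otherwise the factor `a (b (u i))` is zero.
  refine Finset.sum_eq_zero fun i _ => ?_
  by_cases hi : u i = 0
  · rw [hg _ fun j => ?_, smul_zero, smul_zero]
    refine hb _ fun h => ?_
    exact Fin.succAbove_ne i j (hu (h.trans hi.symm))
  · rw [hb _ hi, zero_smul, smul_zero]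

/-! ### Unitary reflections -/

variable {V : Type*} [NormedAddCommGroup V] [InnerProductSpace ℂ V] [FiniteDimensional ℂ V]

/-- A unitary reflection with fixed space `ker a` is `x ↦ x + a x • u` with `a u ≠ 0`. -/
theorem IsUnitaryReflection.exists_eq_add_smul {s : V ≃ₗ[ℂ] V} (hs : IsUnitaryReflection s)
    {a : Dual ℂ V} (ha : LinearMap.ker a = fixedSpace s) :
    ∃ u, (∀ x, s x = x + a x • u) ∧ a u ≠ 0 := by
  have hfix : ∀ x, a x = 0 ↔ s x = x := fun x => by
    rw [← LinearMap.mem_ker, ha, fixedSpace]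
    simp [sub_eq_zero]
  have ha0 : a ≠ 0 := by
    rintro rfl
    have h := hs.2
    rw [← ha, LinearMap.ker_zero, finrank_top] at h
    omega
  obtain ⟨e, he⟩ : ∃ e, a e = 1 := by
    obtain ⟨x, hx⟩ := DFunLike.ne_iff.mp ha0
    exact ⟨(a x)⁻¹ • x, by simp only [map_smul, smul_eq_mul]; exact inv_mul_cancel₀ hx⟩
  have hu : ∀ x, s x = x + a x • (s e - e) := fun x => by
    have h : s (x - a x • e) = x - a x • e := (hfix _).mp (by simp [he])
    rw [map_sub, map_smul, sub_eq_iff_eq_add] at h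
    rw [h, smul_sub]
    abel
  refine ⟨s e - e, hu, fun h => ?_⟩
  -- Unitarity excludes transvections: if `u = s e - e` were fixed, then `⟨s e, u⟩ = ⟨e, u⟩`, so
  -- `⟨u, u⟩ = 0` and `e` would be fixed, although `a e = 1`.
  have h2 := hs.1 e (s e - e)
  rw [(hfix _).mp h, ← sub_eq_zero, ← inner_sub_left, inner_self_eq_zero, sub_eq_zero,
    ← hfix, he] at h2
  exact one_ne_zero h2

theorem det_eq_of_eq_add_smul {s : V ≃ₗ[ℂ] V} {a : Dual ℂ V} {u : V}
    (h : ∀ x, s x = x + a x • u) : LinearMap.det s.toLinearMap = 1 + a u := by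
  rw [← LinearMap.transvection.det]
  congr 1
  ext x
  simp [h, LinearMap.transvection.apply]

theorem IsUnitaryReflection.det_ne_one {s : V ≃ₗ[ℂ] V} (hs : IsUnitaryReflection s)
    {a : Dual ℂ V} (ha : LinearMap.ker a = fixedSpace s) : LinearMap.det s.toLinearMap ≠ 1 := by
  obtain ⟨u, hu, hau⟩ := hs.exists_eq_add_smul ha
  simpa [det_eq_of_eq_add_smul hu] using hau

theorem det_ne_zero (s : V ≃ₗ[ℂ] V) : LinearMap.det s.toLinearMap ≠ 0 :=
  (LinearEquiv.isUnit_det' s).ne_zero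

theorem det_inv (s : V ≃ₗ[ℂ] V) :
    LinearMap.det (s⁻¹ : V ≃ₗ[ℂ] V).toLinearMap = (LinearMap.det s.toLinearMap)⁻¹ := by
  refine eq_inv_of_mul_eq_one_left ?_
  rw [← map_mul, ← LinearMap.det_id (A := ℂ) (M := V)]
  congr 1
  ext x
  exact inv_smul_smul s x

/-- Applying `a` to `s x = x + a x • u` gives the factor `1 + a u = det s`. -/
theorem IsUnitaryReflection.comp_inv {s : V ≃ₗ[ℂ] V} (hs : IsUnitaryReflection s)
    {a : Dual ℂ V} (ha : LinearMap.ker a = fixedSpace s) :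
    a ∘ₗ (s⁻¹ : V ≃ₗ[ℂ] V).toLinearMap = (LinearMap.det s.toLinearMap)⁻¹ • a := by
  obtain ⟨u, hu, hau⟩ := hs.exists_eq_add_smul ha
  have h : ∀ x, a (s x) = LinearMap.det s.toLinearMap * a x := fun x => by
    rw [hu, det_eq_of_eq_add_smul hu]
    simp
    ring
  ext x
  simp only [LinearMap.comp_apply, LinearMap.smul_apply, smul_eq_mul, LinearEquiv.coe_coe]
  rw [eq_inv_mul_iff_mul_eq₀ (det_ne_zero s), ← h]
  exact congrArg a (smul_inv_smul s x)

theorem exists_eq_smul_of_ker_eq {a b : Dual ℂ V} (h : LinearMap.ker a = LinearMap.ker b) :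
    ∃ c : ℂ, b = c • a := by
  have := mem_span_of_iInf_ker_le_ker (L := fun _ : Unit => a) (K := b) (by simp [h])
  obtain ⟨c, hc⟩ := Submodule.mem_span_singleton.mp (by simpa using this)
  exact ⟨c, hc.symm⟩

/-! ### Action on polynomial functions -/

theorem polyAct_ι (w : V ≃ₗ[ℂ] V) (x : Dual ℂ V) :
    polyAct w (SymmetricAlgebra.ι ℂ _ x) =
      SymmetricAlgebra.ι ℂ _ (x ∘ₗ (w⁻¹ : V ≃ₗ[ℂ] V).toLinearMap) :=
  polyActHom_ι w x

theorem polyAct_mul (w w' : V ≃ₗ[ℂ] V) (f : PolyFun V) :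
    polyAct (w * w') f = polyAct w (polyAct w' f) := by
  have : (polyAct (w * w')).toAlgHom = (polyAct w).toAlgHom.comp (polyAct w').toAlgHom := by
    apply SymmetricAlgebra.algHom_ext
    refine LinearMap.ext fun x => ?_
    change polyAct (w * w') (SymmetricAlgebra.ι ℂ _ x) =
      polyAct w (polyAct w' (SymmetricAlgebra.ι ℂ _ x))
    rw [polyAct_ι, polyAct_ι, polyAct_ι, mul_inv_rev]
    rfl
  exact DFunLike.congr_fun this f

theorem polyAct_one (f : PolyFun V) : polyAct (1 : V ≃ₗ[ℂ] V) f = f := by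
  apply (polyAct (1 : V ≃ₗ[ℂ] V)).injective
  rw [← polyAct_mul, mul_one]

/-- A reflection acts trivially on the functions on its hyperplane. -/
theorem IsUnitaryReflection.dvd_polyAct_sub {s : V ≃ₗ[ℂ] V} (hs : IsUnitaryReflection s)
    {a : Dual ℂ V} (ha : LinearMap.ker a = fixedSpace s) (f : PolyFun V) :
    SymmetricAlgebra.ι ℂ _ a ∣ polyAct s f - f := by
  induction f using SymmetricAlgebra.induction with
  | algebraMap r => simp
  | ι x =>
    obtain ⟨u, hu, hau⟩ := hs.exists_eq_add_smul ha
    -- Evaluate `x` on `y = s⁻¹ y + a (s⁻¹ y) • u`, where `a (s⁻¹ y) = det(s)⁻¹ * a y`.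
    have h : x ∘ₗ (s⁻¹ : V ≃ₗ[ℂ] V).toLinearMap - x =
        (-((LinearMap.det s.toLinearMap)⁻¹ * x u)) • a := by
      ext y
      have h1 := hu (s⁻¹ y)
      have h2 : s (s⁻¹ y) = y := smul_inv_smul s y
      have h3 : a (s⁻¹ y) = (LinearMap.det s.toLinearMap)⁻¹ * a y :=
        DFunLike.congr_fun (hs.comp_inv ha) y
      rw [h2, h3] at h1
      have h4 := congrArg x h1
      simp only [map_add, map_smul, smul_eq_mul] at h4
      simp only [LinearMap.sub_apply, LinearMap.comp_apply, LinearEquiv.coe_coe,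
        LinearMap.smul_apply, smul_eq_mul]
      rw [h4]
      ring
    rw [polyAct_ι, ← map_sub, h, map_smul, Algebra.smul_def]
    exact dvd_mul_left _ _
  | mul x y hx hy =>
    rw [map_mul, show polyAct s x * polyAct s y - x * y =
      (polyAct s x - x) * polyAct s y + x * (polyAct s y - y) by ring]
    exact dvd_add (hx.mul_right _) (hy.mul_left _)
  | add x y hx hy =>
    rw [map_add, add_sub_add_comm]
    exact dvd_add hx hy

/-- Modulo `a` the reflection acts trivially, so `(det(s)⁻¹ - 1) • f` is zero there, and the scalar
is invertible because `det s ≠ 1`. -/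
theorem IsUnitaryReflection.dvd_of_polyAct_eq {s : V ≃ₗ[ℂ] V} (hs : IsUnitaryReflection s)
    {a : Dual ℂ V} (ha : LinearMap.ker a = fixedSpace s) {f : PolyFun V}
    (hf : polyAct s f = (LinearMap.det s.toLinearMap)⁻¹ • f) :
    SymmetricAlgebra.ι ℂ _ a ∣ f := by
  have h := hs.dvd_polyAct_sub ha f
  rw [hf, ← one_smul ℂ f, smul_smul, mul_one, ← sub_smul] at h
  have hc : (LinearMap.det s.toLinearMap)⁻¹ - 1 ≠ 0 := by
    rw [sub_ne_zero, ne_eq, inv_eq_one]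
    exact hs.det_ne_one ha
  obtain ⟨g, hg⟩ := h
  refine ⟨((LinearMap.det s.toLinearMap)⁻¹ - 1)⁻¹ • g, ?_⟩
  rw [mul_smul_comm, ← hg, inv_smul_smul₀ hc]

/-- The value of a polynomial function at `v`. -/
noncomputable def evalAt (v : V) : PolyFun V →ₐ[ℂ] ℂ :=
  SymmetricAlgebra.lift (Dual.eval ℂ V v)

theorem evalAt_ι (v : V) (x : Dual ℂ V) : evalAt v (SymmetricAlgebra.ι ℂ _ x) = x v := by
  simp [evalAt]

theorem evalAt_polyAct (w : V ≃ₗ[ℂ] V) (v : V) (f : PolyFun V) :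
    evalAt v (polyAct w f) = evalAt (w⁻¹ v) f := by
  have : (evalAt v).comp (polyAct w).toAlgHom = evalAt (w⁻¹ v) := by
    apply SymmetricAlgebra.algHom_ext
    refine LinearMap.ext fun x => ?_
    change evalAt v (polyAct w (SymmetricAlgebra.ι ℂ _ x)) =
      evalAt (w⁻¹ v) (SymmetricAlgebra.ι ℂ _ x)
    rw [polyAct_ι, evalAt_ι, evalAt_ι]
    rfl
  exact DFunLike.congr_fun this f

/-- Conjugation makes the reflections of `W` permute the arrangement. -/
theorem IsUnitaryReflection.conj {s t : V ≃ₗ[ℂ] V} (hs : IsUnitaryReflection s)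
    (ht : IsUnitaryReflection t) : IsUnitaryReflection (s * t * s⁻¹) ∧
      (fixedSpace t).map s.toLinearMap = fixedSpace (s * t * s⁻¹) := by
  have hinv : ∀ x y : V, inner ℂ (s⁻¹ x) (s⁻¹ y) = inner ℂ x y := fun x y => by
    rw [← hs.1]
    exact congrArg₂ _ (smul_inv_smul s x) (smul_inv_smul s y)
  have hmap : (fixedSpace t).map s.toLinearMap = fixedSpace (s * t * s⁻¹) := by
    ext x
    simp only [fixedSpace, Submodule.mem_map, LinearMap.mem_ker, LinearMap.sub_apply,
      LinearEquiv.coe_coe, LinearMap.id_apply, sub_eq_zero]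
    constructor
    · rintro ⟨y, hy, rfl⟩
      change s (t (s⁻¹ (s y))) = s y
      rw [show s⁻¹ (s y) = y from inv_smul_smul s y, hy]
    · intro h
      have h' : s (t (s⁻¹ x)) = x := h
      have hx : s (s⁻¹ x) = x := smul_inv_smul s x
      exact ⟨s⁻¹ x, s.injective (h'.trans hx.symm), hx⟩
  refine ⟨⟨fun x y => ?_, ?_⟩, hmap⟩
  · change inner ℂ (s (t (s⁻¹ x))) (s (t (s⁻¹ y))) = _
    rw [hs.1, ht.1, hinv]
  · rw [← hmap, ← ht.2, LinearEquiv.finrank_map_eq s]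

/-! ### The arrangement and anti-invariance of `Q` -/

variable {W : Subgroup (V ≃ₗ[ℂ] V)}

theorem finrank_add_one_of_mem_arrangement {H : Submodule ℂ V} (hH : H ∈ arrangement W) :
    finrank ℂ H + 1 = finrank ℂ V := by
  obtain ⟨s, -, hs, rfl⟩ := hH
  exact hs.2

theorem map_mem_arrangement {s : V ≃ₗ[ℂ] V} (hsW : s ∈ W) (hs : IsUnitaryReflection s)
    {H : Submodule ℂ V} (hH : H ∈ arrangement W) : H.map s.toLinearMap ∈ arrangement W := by
  obtain ⟨t, htW, ht, rfl⟩ := hH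
  exact ⟨s * t * s⁻¹, W.mul_mem (W.mul_mem hsW htW) (W.inv_mem hsW), hs.conj ht⟩

theorem ne_zero_of_ker_mem_arrangement {a : Dual ℂ V} (ha : LinearMap.ker a ∈ arrangement W) :
    a ≠ 0 := by
  rintro rfl
  have h := finrank_add_one_of_mem_arrangement ha
  rw [LinearMap.ker_zero, finrank_top] at h
  omega

theorem ι_ne_zero {a : Dual ℂ V} (ha : a ≠ 0) :
    (SymmetricAlgebra.ι ℂ (Dual ℂ V) a : PolyFun V) ≠ 0 := by
  intro h
  refine ha (LinearMap.ext fun v => ?_)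
  rw [← evalAt_ι, h, map_zero, LinearMap.zero_apply]

variable {α : arrangement W → Dual ℂ V}

theorem definingPoly_ne_zero [Finite W]
    (hα : ∀ H : arrangement W, LinearMap.ker (α H) = (H : Submodule ℂ V)) :
    definingPoly α ≠ 0 := by
  have : Fintype (arrangement W) := (finite_arrangement W).fintype
  rw [definingPoly, finprod_eq_prod_of_fintype, Finset.prod_ne_zero_iff]
  intro H _
  exact ι_ne_zero (ne_zero_of_ker_mem_arrangement (W := W) (by rw [hα]; exact H.2))

/-- A hyperplane of the arrangement has a point that lies on no other hyperplane. -/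
theorem exists_mem_forall_ne_zero [Finite W]
    (hα : ∀ H : arrangement W, LinearMap.ker (α H) = (H : Submodule ℂ V)) (H : arrangement W) :
    ∃ v ∈ (H : Submodule ℂ V), ∀ K, K ≠ H → α K v ≠ 0 := by
  have : Finite (arrangement W) := finite_arrangement W
  -- Over an infinite field, `H` is not a finite union of proper subspaces; `H ∩ K` is proper in `H`
  -- because distinct hyperplanes have equal dimension.
  obtain ⟨v, hv, h⟩ := Module.Dual.exists_forall_mem_ne_zero_of_forall_exists
    (H : Submodule ℂ V) (fun K : {K // K ≠ H} => α K) (fun K => by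
      by_contra! hc
      have hle : (H : Submodule ℂ V) ≤ (K : arrangement W) := fun x hx => by
        rw [← hα, LinearMap.mem_ker]
        exact hc x hx
      refine K.2 (Subtype.ext (Submodule.eq_of_le_of_finrank_eq hle ?_).symm)
      have h1 := finrank_add_one_of_mem_arrangement H.2
      have h2 := finrank_add_one_of_mem_arrangement (K : arrangement W).2
      omega)
  exact ⟨v, hv, fun K hK => h ⟨K, hK⟩⟩

/-- As `s` permutes the hyperplanes, it multiplies `Q` by some scalar. The factor `α H` of its own
hyperplane contributes `det(s)⁻¹`. The cofactor `R` contributes `1`, as one sees at a point of `H`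
on no other hyperplane: it is fixed by `s`, and `R` is nonzero there. -/
theorem polyAct_definingPoly_of_isUnitaryReflection [Finite W]
    (hα : ∀ H : arrangement W, LinearMap.ker (α H) = (H : Submodule ℂ V))
    {s : V ≃ₗ[ℂ] V} (hsW : s ∈ W) (hs : IsUnitaryReflection s) :
    polyAct s (definingPoly α) = (LinearMap.det s.toLinearMap)⁻¹ • definingPoly α := by
  classical
  have : Fintype (arrangement W) := (finite_arrangement W).fintype
  let H : arrangement W := ⟨fixedSpace s, s, hsW, hs, rfl⟩
  let f : arrangement W → arrangement W := fun K =>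
    ⟨(K : Submodule ℂ V).map s.toLinearMap, map_mem_arrangement hsW hs K.2⟩
  have hf : Function.Bijective f := by
    rw [← Finite.injective_iff_bijective]
    intro K L h
    exact Subtype.ext (Submodule.map_injective_of_injective s.injective (congrArg Subtype.val h))
  have hc : ∀ K, ∃ c : ℂ, α K ∘ₗ (s⁻¹ : V ≃ₗ[ℂ] V).toLinearMap = c • α (f K) := fun K => by
    refine exists_eq_smul_of_ker_eq ?_
    rw [hα, LinearMap.ker_comp, hα]
    exact Submodule.map_equiv_eq_comap_symm s _
  choose c hc using hc
  have hQ : polyAct s (definingPoly α) = (∏ K, c K) • definingPoly α := by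
    rw [definingPoly, finprod_eq_prod_of_fintype, map_prod]
    simp only [polyAct_ι, hc, map_smul, Algebra.smul_def, Finset.prod_mul_distrib]
    rw [map_prod, hf.prod_comp fun K => SymmetricAlgebra.ι ℂ (Dual ℂ V) (α K)]
  set R : PolyFun V := ∏ K ∈ Finset.univ.erase H, SymmetricAlgebra.ι ℂ (Dual ℂ V) (α K) with hR
  have hQR : definingPoly α = SymmetricAlgebra.ι ℂ (Dual ℂ V) (α H) * R := by
    rw [definingPoly, finprod_eq_prod_of_fintype, hR]
    exact (Finset.mul_prod_erase _ (fun K => SymmetricAlgebra.ι ℂ (Dual ℂ V) (α K))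
      (Finset.mem_univ H)).symm
  obtain ⟨v, hvH, hv⟩ := exists_mem_forall_ne_zero hα H
  have hfix : s⁻¹ v = v := by
    have h : s v = v := by simpa [H, fixedSpace, sub_eq_zero] using hvH
    conv_lhs => rw [← h]
    exact inv_smul_smul s v
  have hRv : evalAt v R ≠ 0 := by
    rw [hR, map_prod, Finset.prod_ne_zero_iff]
    intro K hK
    rw [evalAt_ι]
    exact hv K (Finset.ne_of_mem_erase hK)
  have h1 : SymmetricAlgebra.ι ℂ (Dual ℂ V) (α H) *
      ((LinearMap.det s.toLinearMap)⁻¹ • polyAct s R) =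
      SymmetricAlgebra.ι ℂ (Dual ℂ V) (α H) * ((∏ K, c K) • R) := by
    rw [mul_smul_comm _ _ R, ← hQR, ← hQ, hQR, map_mul, polyAct_ι, hs.comp_inv (hα H), map_smul,
      smul_mul_assoc, mul_smul_comm]
  have h2 := mul_left_cancel₀
    (ι_ne_zero (ne_zero_of_ker_mem_arrangement (W := W) (by rw [hα]; exact H.2))) h1
  have h3 := congrArg (evalAt v) h2
  rw [map_smul, map_smul, evalAt_polyAct, hfix, smul_eq_mul, smul_eq_mul] at h3
  rw [hQ, mul_right_cancel₀ hRv h3]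

/-- The defining polynomial of a reflection arrangement is anti-invariant. -/
theorem polyAct_definingPoly (hW : IsUnitaryReflectionGroup W)
    (hα : ∀ H : arrangement W, LinearMap.ker (α H) = (H : Submodule ℂ V))
    {w : V ≃ₗ[ℂ] V} (hw : w ∈ W) :
    polyAct w (definingPoly α) = (LinearMap.det w.toLinearMap)⁻¹ • definingPoly α := by
  have : Finite W := hW.1
  rw [← hW.2] at hw
  induction hw using Subgroup.closure_induction with
  | mem s hs => exact polyAct_definingPoly_of_isUnitaryReflection hα hs.1 hs.2
  | one =>
    rw [polyAct_one, show ((1 : V ≃ₗ[ℂ] V).toLinearMap) = LinearMap.id from rfl]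
    simp
  | mul x y _ _ hx hy =>
    rw [polyAct_mul, hy, map_smul, hx, smul_smul,
      show (x * y).toLinearMap = x.toLinearMap * y.toLinearMap from rfl, map_mul, mul_inv, mul_comm]
  | inv x _ hx =>
    apply (polyAct x).injective
    rw [← polyAct_mul, mul_inv_cancel, polyAct_one, map_smul, hx, det_inv, inv_inv, smul_smul,
      mul_inv_cancel₀ (det_ne_zero x), one_smul]

/-! ### Differentiating `η / Q` -/

theorem toRat_apply {p : ℕ} (η : PolyForm V p) (v : Fin p → V) :
    η.toRat v = algebraMap (PolyFun V) (RatFun V) (η v) := rfl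

theorem algebraMap_ratFun_injective :
    Function.Injective (algebraMap (PolyFun V) (RatFun V)) :=
  IsFractionRing.injective _ _

/-- Reduces the existence of a polynomial numerator to a check on values. -/
theorem exists_toRat_eq {p : ℕ} {ω : RatForm V p}
    (h : ∀ v, ω v ∈ (algebraMap (PolyFun V) (RatFun V)).range) :
    ∃ ξ : PolyForm V p, ξ.toRat = ω := by
  let f : PolyFun V →ₗ[ℂ] RatFun V := (IsScalarTower.toAlgHom ℂ (PolyFun V) (RatFun V)).toLinearMap
  have hf : Function.Injective f := algebraMap_ratFun_injective
  let e := LinearEquiv.ofInjective f hf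
  refine ⟨e.symm.toLinearMap.compAlternatingMap (ω.codRestrict (LinearMap.range f) h), ?_⟩
  ext v
  exact congrArg Subtype.val (e.apply_symm_apply (ω.codRestrict (LinearMap.range f) h v))

theorem partialDeriv_algebraMap_mem_range (v : V) (f : PolyFun V) :
    partialDeriv v (algebraMap (PolyFun V) (RatFun V) f) ∈
      (algebraMap (PolyFun V) (RatFun V)).range := by
  induction f using SymmetricAlgebra.induction with
  | algebraMap r =>
    rw [← IsScalarTower.algebraMap_apply, Derivation.map_algebraMap]
    exact zero_mem _
  | ι x =>
    rw [← linRat_apply, partialDeriv_linRat]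
    exact ⟨algebraMap ℂ _ (x v), (IsScalarTower.algebraMap_apply _ _ _ _).symm⟩
  | mul a b ha hb =>
    rw [map_mul, Derivation.leibniz]
    exact add_mem (mul_mem ⟨a, rfl⟩ hb) (mul_mem ⟨b, rfl⟩ ha)
  | add a b ha hb =>
    rw [map_add, map_add]
    exact add_mem ha hb

theorem derivation_prod {R K ι : Type*} [CommRing R] [Field K] [Algebra R K]
    (D : Derivation R K K) (s : Finset ι) {x : ι → K} (hx : ∀ i ∈ s, x i ≠ 0) :
    D (∏ i ∈ s, x i) = (∏ i ∈ s, x i) * ∑ i ∈ s, (x i)⁻¹ * D (x i) := by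
  classical
  induction s using Finset.induction_on with
  | empty => simp
  | insert a s ha ih =>
    have h := hx a (Finset.mem_insert_self a s)
    rw [Finset.prod_insert ha, Finset.sum_insert ha, Derivation.leibniz,
      ih fun i hi => hx i (Finset.mem_insert_of_mem hi)]
    simp only [smul_eq_mul]
    field_simp
    ring

theorem mul_derivation_inv_mul {R K : Type*} [CommRing R] [Field K] [Algebra R K]
    (D : Derivation R K K) {q : K} (hq : q ≠ 0) (y : K) :
    q * D (q⁻¹ * y) = D y - q⁻¹ * D q * y := by
  rw [Derivation.leibniz, Derivation.leibniz_inv]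
  simp only [smul_eq_mul]
  field_simp
  ring

/-- If `η` is multiplied by `det(s)⁻¹` under the reflection `s` in `ker a`, then `a` divides
`da ∧ η`. -/
theorem IsUnitaryReflection.dvd_sum_smul_removeNth {s : V ≃ₗ[ℂ] V} (hs : IsUnitaryReflection s)
    {a : Dual ℂ V} (ha : LinearMap.ker a = fixedSpace s) {p : ℕ} {η : PolyForm V p}
    (hη : polyFormAct s η = (LinearMap.det s.toLinearMap)⁻¹ • η) (v : Fin (p + 1) → V) :
    SymmetricAlgebra.ι ℂ (Dual ℂ V) a ∣
      ∑ i : Fin (p + 1), (-1) ^ (i : ℕ) • a (v i) • η (i.removeNth v) := by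
  -- Divisibility by `a` becomes vanishing in `S / (a)`, where the wedge lemma applies to the
  -- reduction of `η`.
  let I : Ideal (PolyFun V) := Ideal.span {SymmetricAlgebra.ι ℂ (Dual ℂ V) a}
  have hmk : ∀ f : PolyFun V, Ideal.Quotient.mkₐ ℂ I f = 0 ↔
      SymmetricAlgebra.ι ℂ (Dual ℂ V) a ∣ f := fun f => by
    rw [Ideal.Quotient.mkₐ_eq_mk, Ideal.Quotient.eq_zero_iff_mem, Ideal.mem_span_singleton]
  have h := sum_smul_removeNth_eq_zero a
    ((Ideal.Quotient.mkₐ ℂ I).toLinearMap.compAlternatingMap η) (fun u hu => ?_) v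
  · rw [← hmk, ← h, map_sum]
    refine Finset.sum_congr rfl fun i _ => ?_
    rw [map_zsmul, map_smul]
    rfl
  · refine (hmk _).mpr (hs.dvd_of_polyAct_eq ha ?_)
    -- The arguments lie in the hyperplane, so anti-invariance of the form becomes an equation for
    -- the single polynomial `η u`.
    have hfix : (fun i => s⁻¹ (u i)) = u := funext fun i => by
      have h1 : u i ∈ fixedSpace s := ha ▸ LinearMap.mem_ker.mpr (hu i)
      have h2 : s (u i) = u i := by simpa [fixedSpace, sub_eq_zero] using h1
      conv_lhs => rw [← h2]
      exact inv_smul_smul s (u i)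
    have h3 : polyAct s (η fun i => s⁻¹ (u i)) = (LinearMap.det s.toLinearMap)⁻¹ • η u :=
      DFunLike.congr_fun hη u
    rwa [hfix] at h3

theorem partialDeriv_definingPoly [Finite W] [Fintype (arrangement W)]
    (hα : ∀ H : arrangement W, LinearMap.ker (α H) = (H : Submodule ℂ V)) (v : V) :
    partialDeriv v (algebraMap (PolyFun V) (RatFun V) (definingPoly α)) =
      algebraMap (PolyFun V) (RatFun V) (definingPoly α) *
        ∑ H, (linRat (α H))⁻¹ * algebraMap ℂ (RatFun V) (α H v) := by
  rw [definingPoly, finprod_eq_prod_of_fintype, map_prod]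
  simp only [← linRat_apply]
  rw [derivation_prod]
  · simp only [partialDeriv_linRat]
  · intro H _
    rw [linRat_apply, map_ne_zero_iff _ algebraMap_ratFun_injective]
    exact ι_ne_zero (ne_zero_of_ker_mem_arrangement (W := W) (by rw [hα]; exact H.2))

/-- The quotient rule and the logarithmic derivative of `Q` give `Q · d(η / Q) = dη - ∑ (dα_H / α_H)
∧ η`, whose terms are all polynomial. -/
theorem extD_divForm_of_mem_antiInvariantForms [Finite W]
    (hα : ∀ H : arrangement W, LinearMap.ker (α H) = (H : Submodule ℂ V)) {p : ℕ}
    {η : PolyForm V p} (hη : η ∈ antiInvariantForms W p) :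
    ∃ ξ : PolyForm V (p + 1),
      extD (divForm (definingPoly α) η) = divForm (definingPoly α) ξ := by
  have : Fintype (arrangement W) := (finite_arrangement W).fintype
  set q := algebraMap (PolyFun V) (RatFun V) (definingPoly α) with hq
  have hq0 : q ≠ 0 := by
    rw [hq, map_ne_zero_iff _ algebraMap_ratFun_injective]
    exact definingPoly_ne_zero hα
  obtain ⟨ξ, hξ⟩ := exists_toRat_eq (ω := q • extD (divForm (definingPoly α) η)) fun v => by
    have key : ∀ i : Fin (p + 1), q * partialDeriv (v i)
        (divForm (definingPoly α) η (i.removeNth v)) =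
        partialDeriv (v i) (algebraMap (PolyFun V) (RatFun V) (η (i.removeNth v))) -
          ∑ H, (linRat (α H))⁻¹ *
            algebraMap (PolyFun V) (RatFun V) (α H (v i) • η (i.removeNth v)) := fun i => by
      change q * partialDeriv (v i) (q⁻¹ *
        algebraMap (PolyFun V) (RatFun V) (η (i.removeNth v))) = _
      rw [mul_derivation_inv_mul _ hq0, hq, partialDeriv_definingPoly hα, ← hq,
        inv_mul_cancel_left₀ hq0, Finset.sum_mul]
      simp only [Algebra.smul_def, map_mul, ← IsScalarTower.algebraMap_apply, mul_assoc]
    rw [AlternatingMap.smul_apply, extD_apply, Finset.smul_sum]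
    simp only [smul_comm q, smul_eq_mul, key, smul_sub, Finset.smul_sum]
    -- Grouping by hyperplane matters: only the whole alternating sum for a given `H`, not its
    -- single terms, need be divisible by `α H`.
    rw [Finset.sum_sub_distrib, Finset.sum_comm]
    refine sub_mem (sum_mem fun i _ => zsmul_mem (partialDeriv_algebraMap_mem_range _ _) _)
      (sum_mem fun H _ => ?_)
    obtain ⟨s, hsW, hs, hH⟩ := H.2
    obtain ⟨g, hg⟩ := hs.dvd_sum_smul_removeNth ((hα H).trans hH) (hη s hsW) v
    have hne : linRat (α H) ≠ 0 := by
      rw [linRat_apply, map_ne_zero_iff _ algebraMap_ratFun_injective]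
      exact ι_ne_zero (ne_zero_of_ker_mem_arrangement (W := W) (by rw [hα]; exact H.2))
    refine ⟨g, ?_⟩
    have h2 := congrArg (algebraMap (PolyFun V) (RatFun V)) hg
    rw [map_mul, ← linRat_apply, map_sum, ← inv_mul_eq_iff_eq_mul₀ hne, Finset.mul_sum] at h2
    rw [← h2]
    refine Finset.sum_congr rfl fun i _ => ?_
    rw [map_zsmul, mul_smul_comm]
  refine ⟨ξ, ?_⟩
  rw [divForm.eq_def _ ξ, hξ, ← hq, smul_smul, inv_mul_cancel₀ hq0, one_smul]

/-! ### Invariance of `η / Q` -/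

theorem divForm_injective {Q : PolyFun V} (hQ : Q ≠ 0) {p : ℕ} :
    Function.Injective (divForm Q (p := p)) := by
  intro η ξ h
  ext v
  have h1 := DFunLike.congr_fun h v
  have hq0 : algebraMap (PolyFun V) (RatFun V) Q ≠ 0 :=
    (map_ne_zero_iff _ algebraMap_ratFun_injective).mpr hQ
  exact algebraMap_ratFun_injective (mul_left_cancel₀ (inv_ne_zero hq0) h1)

theorem ratAct_algebraMap (w : V ≃ₗ[ℂ] V) (f : PolyFun V) :
    ratAct w (algebraMap (PolyFun V) (RatFun V) f) =
      algebraMap (PolyFun V) (RatFun V) (polyAct w f) := by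
  simp [ratAct]

theorem ratFormAct_divForm {Q : PolyFun V} {w : V ≃ₗ[ℂ] V} {c : ℂ} (h : polyAct w Q = c⁻¹ • Q)
    {p : ℕ} (η : PolyForm V p) :
    ratFormAct w (divForm Q η) = divForm Q (c • polyFormAct w η) := by
  ext v
  change ratAct w ((algebraMap (PolyFun V) (RatFun V) Q)⁻¹ *
    algebraMap (PolyFun V) (RatFun V) (η fun i => w⁻¹ (v i))) =
    (algebraMap (PolyFun V) (RatFun V) Q)⁻¹ *
      algebraMap (PolyFun V) (RatFun V) (c • polyAct w (η fun i => w⁻¹ (v i)))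
  rw [map_mul, map_inv₀, ratAct_algebraMap, ratAct_algebraMap, h]
  simp only [Algebra.smul_def, map_mul, ← IsScalarTower.algebraMap_apply, mul_inv, map_inv₀,
    inv_inv]
  ring

end ReflArr

theorem corollary2 {V : Type*} [NormedAddCommGroup V] [InnerProductSpace ℂ V]
    [FiniteDimensional ℂ V] (W : Subgroup (V ≃ₗ[ℂ] V))
    (hW : ReflArr.IsUnitaryReflectionGroup W)
    (α : ReflArr.arrangement W → Module.Dual ℂ V)
    (hα : ∀ H : ReflArr.arrangement W, LinearMap.ker (α H) = (H : Submodule ℂ V))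
    (p : ℕ) (hp : p ≤ Module.finrank ℂ V) :
    ReflArr.invariants W (ReflArr.logForms (ReflArr.definingPoly α) p) =
      ReflArr.divForm (ReflArr.definingPoly α) '' ReflArr.antiInvariantForms W p := by
  have : Finite W := hW.1
  have hiff : ∀ η : ReflArr.PolyForm V p,
      (∀ w ∈ W, ReflArr.ratFormAct w (ReflArr.divForm (ReflArr.definingPoly α) η) =
        ReflArr.divForm (ReflArr.definingPoly α) η) ↔ η ∈ ReflArr.antiInvariantForms W p := by
    refine fun η => forall₂_congr fun w hw => ?_
    rw [ReflArr.ratFormAct_divForm (ReflArr.polyAct_definingPoly hW hα hw),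
      (ReflArr.divForm_injective (ReflArr.definingPoly_ne_zero hα)).eq_iff,
      -- With `c = det w`, invariance of `η / Q` reads `c • w η = η`.
      eq_inv_smul_iff₀ (ReflArr.det_ne_zero w)]
  ext ω
  constructor
  · rintro ⟨⟨⟨η, rfl⟩, -⟩, h⟩
    exact ⟨η, (hiff η).mp h, rfl⟩
  · rintro ⟨η, hη, rfl⟩
    exact ⟨⟨⟨η, rfl⟩, ReflArr.extD_divForm_of_mem_antiInvariantForms hα hη⟩, (hiff η).mpr hη⟩
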